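/- Let $d\ge 3$, let $S=\mathbb C[x,y,z]$, and let $f\in S$ be a squarefree homogeneous polynomial of degree $d$, so that $C: f=0$ is a reduced curve of degree $d$ in the complex projective plane. Let $$D_0(f)=\{(a,b,c)\in S^3 : a f_x+b f_y+c f_z=0\}$$ be the graded $S$-module of Jacobian syzygies of $f$, where $(a,b,c)$ is homogeneous of degree $k$ if $a,b,c$ are homogeneous of degree $k$. The curve $C$ is said to be of type $(d,r,m)$ if $D_0(f)$ has a minimal set of homogeneous generators consisting of exactly $m$ syzygies, all of degree $r$. Then $C$ is of type $(d,d-1,3)$ if and only if $C$ is smooth. Moreover, in that case $D_0(f)$ is generated by the three Koszul syzygies $(0,f_z,-f_y)$, $(-f_z,0,f_x)$, $(f_y,-f_x,0)$. -/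

import Mathlib

namespace PlaneCurve

open MvPolynomial

/-- The graded polynomial ring `ℂ[x, y, z]`. -/
abbrev Poly : Type := MvPolynomial (Fin 3) ℂ

/-- The module `D₀(f)` of Jacobian syzygies of `f`: all triples `(a, b, c)` of polynomials with
`a f_x + b f_y + c f_z = 0`. -/
noncomputable def jacobianSyzygies (f : Poly) : Submodule Poly (Fin 3 → Poly) where
  carrier := {ρ | ∑ i, ρ i * pderiv i f = 0}
  zero_mem' := by simp
  add_mem' := by
    intro a b ha hb
    simp only [Set.mem_ofPred_eq] at ha hb ⊢
    simp only [Pi.add_apply, add_mul, Finset.sum_add_distrib, ha, hb, add_zero]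
  smul_mem' := by
    intro c a ha
    simp only [Set.mem_ofPred_eq] at ha ⊢
    simp only [Pi.smul_apply, smul_eq_mul, mul_assoc, ← Finset.mul_sum, ha, mul_zero]

/-- The family `ρ` is a minimal set of homogeneous generators of `D₀(f)`, with `deg ρ_j = e_j`:
the components of `ρ_j` are homogeneous of degree `e_j`, the `ρ_j` generate `D₀(f)` over
`ℂ[x, y, z]`, and none of them lies in the submodule generated by the others. -/
structure IsMinimalGenerators (f : Poly) {m : ℕ} (ρ : Fin m → Fin 3 → Poly)
    (e : Fin m → ℕ) : Prop where
  homogeneous : ∀ j i, (ρ j i).IsHomogeneous (e j)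
  span_eq : Submodule.span Poly (Set.range ρ) = jacobianSyzygies f
  minimal : ∀ j, ρ j ∉ Submodule.span Poly (ρ '' {k | k ≠ j})

/-- The curve `f = 0` is an `m`-syzygy curve with exponents `e_1 ≤ ⋯ ≤ e_m`. -/
def HasExponents (f : Poly) {m : ℕ} (e : Fin m → ℕ) : Prop :=
  Monotone e ∧ ∃ ρ : Fin m → Fin 3 → Poly, IsMinimalGenerators f ρ e

/-- The curve `f = 0` is of type `(d, r, m)`: it has degree `d`, and it is an `m`-syzygy curve
all of whose exponents are equal to `r`. -/
def IsOfType (f : Poly) (d r m : ℕ) : Prop :=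
  f.IsHomogeneous d ∧ HasExponents f (fun _ : Fin m => r)

/-- The projective curve `f = 0` is smooth: at every point of the projective plane that lies on
the curve, given by a nonzero vector of homogeneous coordinates, some first order partial
derivative of `f` does not vanish. -/
def IsSmooth (f : Poly) : Prop :=
  ∀ p : Fin 3 → ℂ, p ≠ 0 → eval p f = 0 → ∃ i, eval p (pderiv i f) ≠ 0

/-- The three Koszul syzygies `(0, f_z, -f_y)`, `(-f_z, 0, f_x)`, `(f_y, -f_x, 0)`. -/
noncomputable def koszulSyzygy (f : Poly) : Fin 3 → Fin 3 → Poly :=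
  ![![0, pderiv 2 f, -pderiv 1 f],
    ![-pderiv 2 f, 0, pderiv 0 f],
    ![pderiv 1 f, -pderiv 0 f, 0]]

/-- The module of Jacobian syzygies is generated by the Koszul syzygies. -/
def IsKoszulGenerated (f : Poly) : Prop :=
  jacobianSyzygies f = Submodule.span Poly (Set.range (koszulSyzygy f))

end PlaneCurve

/-!
By Euler's formula a singular point is a common zero of `f_x`, `f_y`, `f_z`, so by the
Nullstellensatz smoothness makes the Jacobian ideal contain powers of `x`, `y`, `z`. These form a
regular sequence, and a Čech argument with them shows that the Koszul complex of the gradient has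
no first homology: all Jacobian syzygies are Koszul syzygies.

Suppose conversely that the Koszul syzygies generate. Then the entries of every syzygy vanish to
order `d - 1` at the origin, which forces `f_x ≠ 0` and `f_x`, `f_y` coprime, so the ideal
`(f_x, f_y)` has height at least two. The partial derivatives all vanish at a singular point, hence
lie in its homogeneous prime ideal `P`, of height at most two. Then `P` is minimal over
`(f_x, f_y)`, so its element `f_z` is a zero divisor modulo `(f_x, f_y)`: a relation
`g f_z = a f_x + b f_y` with `g ∉ (f_x, f_y)` is a syzygy that is not Koszul.

Syzygies of degree `d - 1` in the module generated by three syzygies of degree `d - 1` are their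
`ℂ`-linear combinations. Since the Koszul syzygies are linearly independent over `ℂ`, they span the
same three-dimensional space as any three generators of degree `d - 1`.
-/

namespace PlaneCurve

open Matrix MvPolynomial RingTheory.Sequence

section RegularSequence

variable {R : Type*} [CommRing R]

theorem isWeaklyRegular_iff_forall_mem_ofList {rs : List R} :
    IsWeaklyRegular R rs ↔ ∀ (i : ℕ) (hi : i < rs.length) (a : R),
      rs[i] * a ∈ Ideal.ofList (rs.take i) → a ∈ Ideal.ofList (rs.take i) := by
  simp only [isWeaklyRegular_iff, smul_eq_mul, Ideal.mul_top,
    isSMulRegular_quotient_iff_mem_of_smul_mem]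

theorem dvd_of_isWeaklyRegular_of_mul_eq_mul {x y a b : R} (hreg : IsWeaklyRegular R [x, y])
    (h : y * a = x * b) : x ∣ a := by
  have hmem := isWeaklyRegular_iff_forall_mem_ofList.mp hreg 1 (by simp) a
  simp only [List.getElem_cons_succ, List.getElem_cons_zero, List.take_succ_cons, List.take_zero,
    Ideal.ofList_singleton, Ideal.mem_span_singleton] at hmem
  exact hmem ⟨b, h⟩

theorem mem_span_pair_of_isWeaklyRegular_of_add_eq_zero {x y z a b c : R}
    (hreg : IsWeaklyRegular R [x, y, z]) (h : x * a + y * b + z * c = 0) :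
    c ∈ Ideal.span {x, y} := by
  have hmem := isWeaklyRegular_iff_forall_mem_ofList.mp hreg 2 (by simp) c
  simp only [List.getElem_cons_succ, List.getElem_cons_zero, List.take_succ_cons, List.take_zero,
    Ideal.ofList_cons, Ideal.ofList_nil, sup_bot_eq, ← Ideal.span_insert] at hmem
  exact hmem (Ideal.mem_span_pair.mpr ⟨-a, -b, by linear_combination -h⟩)

theorem mem_span_X_pow_image_of_X_pow_mul_mem {σ : Type*} {s : Set σ} {k : σ} (hk : k ∉ s)
    (e : σ → ℕ) (n : ℕ) {p : MvPolynomial σ R}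
    (hp : X k ^ n * p ∈ Ideal.span ((fun i => (X i : MvPolynomial σ R) ^ e i) '' s)) :
    p ∈ Ideal.span ((fun i => (X i : MvPolynomial σ R) ^ e i) '' s) := by
  have himage : (fun i => (X i : MvPolynomial σ R) ^ e i) '' s =
      (fun m => monomial m (1 : R)) '' ((fun i => Finsupp.single i (e i)) '' s) := by
    simp only [Set.image_image, X_pow_eq_monomial]
  rw [himage, mem_ideal_span_monomial_image] at hp ⊢
  intro m hm
  obtain ⟨_, ⟨i, his, rfl⟩, hle⟩ := hp (Finsupp.single k n + m) (by
    rwa [mem_support_iff, X_pow_eq_monomial, coeff_monomial_mul, one_mul, ← mem_support_iff])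
  have hki : k ≠ i := fun h => hk (h ▸ his)
  refine ⟨_, ⟨i, his, rfl⟩, Finsupp.single_le_iff.mpr ?_⟩
  simpa [hki] using Finsupp.single_le_iff.mp hle

theorem isWeaklyRegular_map_X_pow {σ : Type*} {l : List σ} (hl : l.Nodup) (e : σ → ℕ) :
    IsWeaklyRegular (MvPolynomial σ R) (l.map fun i => (X i : MvPolynomial σ R) ^ e i) := by
  refine isWeaklyRegular_iff_forall_mem_ofList.mpr fun i hi a ha => ?_
  rw [List.length_map] at hi
  have hofList : Ideal.ofList ((l.map fun i => (X i : MvPolynomial σ R) ^ e i).take i) =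
      Ideal.span ((fun i => (X i : MvPolynomial σ R) ^ e i) '' {j | j ∈ l.take i}) := by
    rw [← List.map_take, Ideal.ofList]
    exact congrArg Ideal.span (Set.ext fun _ => List.mem_map)
  have hnotMem : l[i] ∉ l.take i := by
    rw [List.mem_take_iff_getElem]
    rintro ⟨j, hj, hji⟩
    have := hl.getElem_inj_iff.mp hji
    omega
  rw [hofList, List.getElem_map] at ha
  rw [hofList]
  exact mem_span_X_pow_image_of_X_pow_mul_mem (s := {j | j ∈ l.take i}) hnotMem e _ ha

end RegularSequence

section Koszul

variable {R : Type*} [CommRing R]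

theorem span_range_cross_single (w : Fin 3 → R) :
    Submodule.span R (Set.range fun j => w ⨯₃ Pi.single j 1) =
      LinearMap.range (crossProduct w) := by
  rw [LinearMap.range_eq_map, ← (Pi.basisFun R (Fin 3)).span_eq, Submodule.map_span,
    ← Set.range_comp]
  simp only [Function.comp_def, Pi.basisFun_apply]

theorem linearIndependent_cross_single {A : Type*} [CommRing A] [Algebra R A] {w : Fin 3 → A}
    (hw : LinearIndependent R w) :
    LinearIndependent R fun j => w ⨯₃ Pi.single j (1 : A) := by
  rw [Fintype.linearIndependent_iff] at hw ⊢
  intro α hα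
  have h0 : α 2 • w 1 - α 1 • w 2 = 0 := by
    simpa [Fin.sum_univ_three, cross_apply, sub_eq_neg_add] using congrFun hα 0
  have h1 : α 0 • w 2 - α 2 • w 0 = 0 := by
    simpa [Fin.sum_univ_three, cross_apply, sub_eq_add_neg] using congrFun hα 1
  have hv := hw ![0, α 2, -α 1] (by simpa [Fin.sum_univ_three, sub_eq_add_neg] using h0)
  have hu := hw ![-α 2, 0, α 0] (by simpa [Fin.sum_univ_three, sub_eq_neg_add] using h1)
  intro i
  fin_cases i
  · exact hu 2
  · exact neg_eq_zero.mp (hv 2)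
  · exact hv 1

theorem eq_zero_of_smul_eq_zero_of_mem_span {ι : Type*} {w : ι → R} {x c : R}
    (hx : IsSMulRegular R x) (hxw : x ∈ Ideal.span (Set.range w)) (hc : c • w = 0) : c = 0 := by
  have hle : Ideal.span (Set.range w) ≤ LinearMap.ker (LinearMap.mulLeft R c) := by
    rw [Ideal.span_le]
    rintro _ ⟨i, rfl⟩
    exact congrFun hc i
  exact hx.right_eq_zero_of_smul ((mul_comm x c).trans (hle hxw))

theorem exists_eq_smul_of_cross_eq_zero {x y : R} (hreg : IsWeaklyRegular R [x, y])
    {w v : Fin 3 → R} (hx : x ∈ Ideal.span (Set.range w)) (hy : y ∈ Ideal.span (Set.range w))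
    (hv : w ⨯₃ v = 0) : ∃ c : R, v = c • w := by
  have hxreg : IsSMulRegular R x := ((isWeaklyRegular_cons_iff R x [y]).mp hreg).1
  have hparallel {t : R} (ht : t ∈ Ideal.span (Set.range w)) : ∃ a : R, t • v = a • w := by
    obtain ⟨u, rfl⟩ := Ideal.mem_span_range_iff_exists_fun.mp ht
    have htriple := cross_cross_eq_smul_sub_smul' u w v
    rw [hv, map_zero, dotProduct_comm w u] at htriple
    exact ⟨u ⬝ᵥ v, (sub_eq_zero.mp htriple.symm).symm⟩
  obtain ⟨a, ha⟩ := hparallel hx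
  obtain ⟨b, hb⟩ := hparallel hy
  have hab : y * a = x * b := by
    refine sub_eq_zero.mp (eq_zero_of_smul_eq_zero_of_mem_span hxreg hx ?_)
    rw [sub_smul, mul_smul, mul_smul, ← ha, ← hb, smul_comm, sub_self]
  obtain ⟨c, rfl⟩ := dvd_of_isWeaklyRegular_of_mul_eq_mul hreg hab
  refine ⟨c, funext fun i => hxreg ?_⟩
  rw [mul_smul] at ha
  exact congrFun ha i

theorem mem_range_cross_of_dotProduct_eq_zero {x : Fin 3 → R}
    (hreg : IsWeaklyRegular R [x 0, x 1, x 2]) {w r : Fin 3 → R}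
    (hx : ∀ i, x i ∈ Ideal.span (Set.range w)) (hr : w ⬝ᵥ r = 0) :
    r ∈ LinearMap.range (crossProduct w) := by
  have hreg₂ : IsWeaklyRegular R [x 0, x 1] :=
    ((isWeaklyRegular_append_iff R [x 0, x 1] [x 2]).mp hreg).1
  have hxreg : IsSMulRegular R (x 0) := ((isWeaklyRegular_cons_iff R (x 0) _).mp hreg).1
  have hlift (i : Fin 3) : ∃ s : Fin 3 → R, w ⨯₃ s = x i • r := by
    obtain ⟨u, hu⟩ := Ideal.mem_span_range_iff_exists_fun.mp (hx i)
    refine ⟨r ⨯₃ u, ?_⟩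
    rw [cross_cross_eq_smul_sub_smul', dotProduct_comm r w, hr, zero_smul, sub_zero,
      dotProduct_comm, ← hu]
    rfl
  choose s hs using hlift
  -- The differences `s i / x i - s j / x j` are multiples of `w`. The coefficients form a Čech
  -- cocycle, and writing it as a coboundary corrects `s 0` to a multiple of `x 0`.
  have hsyzygy (i j : Fin 3) : ∃ c : R, x j • s i - x i • s j = c • w := by
    refine exists_eq_smul_of_cross_eq_zero hreg₂ (hx 0) (hx 1) ?_
    rw [map_sub, map_smul, map_smul, hs, hs, smul_comm, sub_self]
  obtain ⟨c₀, hc₀⟩ := hsyzygy 1 2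
  obtain ⟨c₁, hc₁⟩ := hsyzygy 2 0
  obtain ⟨c₂, hc₂⟩ := hsyzygy 0 1
  have hcocycle : x 0 * c₀ + x 1 * c₁ + x 2 * c₂ = 0 := by
    refine eq_zero_of_smul_eq_zero_of_mem_span hxreg (hx 0) ?_
    simp only [add_smul, mul_smul, ← hc₀, ← hc₁, ← hc₂]
    module
  obtain ⟨a, b, hab⟩ :=
    Ideal.mem_span_pair.mp (mem_span_pair_of_isWeaklyRegular_of_add_eq_zero hreg hcocycle)
  have hdvd (i : Fin 3) : x 0 ∣ (s 0 - b • w) i := by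
    refine dvd_of_isWeaklyRegular_of_mul_eq_mul (b := (s 1 + a • w) i) hreg₂ ?_
    have hi := congrFun hc₂ i
    simp only [Pi.sub_apply, Pi.add_apply, Pi.smul_apply, smul_eq_mul] at hi ⊢
    linear_combination hi - w i * hab
  choose k hk using hdvd
  refine ⟨k, funext fun i => hxreg ?_⟩
  have hs₀ : s 0 - b • w = x 0 • k := funext hk
  have hcross : x 0 • (w ⨯₃ k) = x 0 • r := by
    rw [← map_smul, ← hs₀, map_sub, map_smul, cross_self, smul_zero, sub_zero, hs]
  exact congrFun hcross i

end Koszul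

section Height

theorem two_le_height_span_pair_of_isRelPrime {R : Type*} [CommRing R] [IsDomain R]
    [UniqueFactorizationMonoid R] {a b : R} (ha : a ≠ 0) (hab : IsRelPrime a b) :
    2 ≤ (Ideal.span {a, b}).height := by
  rw [Ideal.height_eq_inf_minimalPrimes, le_iInf₂_iff]
  intro Q hQ
  have : Q.IsPrime := hQ.isPrime
  have haQ : a ∈ Q := hQ.le (Ideal.subset_span (by simp))
  have hbQ : b ∈ Q := hQ.le (Ideal.subset_span (by simp))
  have hzero : Q.height ≠ 0 := by
    rw [Ne, Ideal.height_eq_zero_iff_eq_bot]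
    rintro rfl
    exact ha haQ
  have hone : Q.height ≠ 1 := by
    intro h
    obtain ⟨q, rfl⟩ := UniqueFactorizationMonoid.isPrincipal_of_height_eq_one h
    have hq : IsUnit q := hab (Ideal.mem_span_singleton.mp haQ) (Ideal.mem_span_singleton.mp hbQ)
    exact this.ne_top (Ideal.span_singleton_eq_top.mpr hq)
  have hpos : 1 < Q.height :=
    lt_of_le_of_ne (Order.one_le_iff_pos.mpr (pos_iff_ne_zero.mpr hzero)) hone.symm
  simpa only [one_add_one_eq_two] using Order.add_one_le_of_lt hpos

theorem two_lt_height_of_forall_mem_range_cross {R : Type*} [CommRing R] [IsDomain R]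
    [UniqueFactorizationMonoid R] {w : Fin 3 → R} (hw : w 0 ≠ 0) (hrel : IsRelPrime (w 0) (w 1))
    (hkoszul : ∀ r, w ⬝ᵥ r = 0 → r ∈ LinearMap.range (crossProduct w)) {P : Ideal R}
    [P.IsPrime] (hP : ∀ i, w i ∈ P) : 2 < P.height := by
  by_contra! hle
  have : P.FiniteHeight :=
    (Ideal.finiteHeight_iff P).mpr (Or.inr (ne_top_of_le_ne_top (by simp) hle))
  have hmin : P ∈ (Ideal.span {w 0, w 1}).minimalPrimes := by
    refine Ideal.mem_minimalPrimes_of_height_le (Ideal.span_le.mpr ?_)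
      (hle.trans (two_le_height_span_pair_of_isRelPrime hw hrel))
    rintro _ (rfl | rfl) <;> exact hP _
  obtain ⟨g, hg, hmul⟩ := Ideal.exists_mul_mem_of_mem_minimalPrimes hmin (hP 2)
  obtain ⟨a, b, hab⟩ := Ideal.mem_span_pair.mp hmul
  obtain ⟨k, hk⟩ := hkoszul ![a, b, -g] (by
    simp only [dotProduct, Fin.sum_univ_three, cons_val]
    linear_combination hab)
  have hlast : w 0 * k 1 - w 1 * k 0 = -g := congrFun hk 2
  exact hg (Ideal.mem_span_pair.mpr ⟨-k 1, k 0, by linear_combination -hlast⟩)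

end Height

section Homogeneous

variable {σ ι R : Type*} [CommSemiring R]

attribute [local instance] MvPolynomial.gradedAlgebra

theorem homogeneousComponent_mul_of_isHomogeneous (a : MvPolynomial σ R) {p : MvPolynomial σ R}
    {n : ℕ} (hp : p.IsHomogeneous n) :
    homogeneousComponent n (a * p) = constantCoeff a • p := by
  have h := DirectSum.coe_decompose_mul_of_right_mem_of_le (homogeneousSubmodule σ R) (a := a)
    ((mem_homogeneousSubmodule n p).mpr hp) le_rfl
  simp only [Nat.sub_self, DirectSum.decompose, Equiv.coe_fn_mk, decomposition.decompose'_apply,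
    homogeneousComponent_zero] at h
  rwa [smul_eq_C_mul, constantCoeff_eq]

theorem homogeneousComponent_mem_span_of_mem_span {S : Set (ι → MvPolynomial σ R)} {n : ℕ}
    (hS : ∀ s ∈ S, ∀ i, (s i).IsHomogeneous n) {v : ι → MvPolynomial σ R}
    (hv : v ∈ Submodule.span (MvPolynomial σ R) S) :
    (homogeneousComponent n).compLeft ι v ∈ Submodule.span R S := by
  induction hv using Submodule.closure_induction with
  | zero => simpa only [map_zero] using zero_mem (Submodule.span R S)
  | add u w _ _ hu hw => simpa only [map_add] using add_mem hu hw
  | smul_mem a s hs =>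
    have hsmul : (homogeneousComponent n).compLeft ι (a • s) = constantCoeff a • s :=
      funext fun i => homogeneousComponent_mul_of_isHomogeneous a (hS s hs i)
    rw [hsmul]
    exact Submodule.smul_mem _ _ (Submodule.subset_span hs)

theorem mem_span_of_mem_span_of_isHomogeneous {S : Set (ι → MvPolynomial σ R)} {n : ℕ}
    (hS : ∀ s ∈ S, ∀ i, (s i).IsHomogeneous n) {v : ι → MvPolynomial σ R}
    (hv : ∀ i, (v i).IsHomogeneous n) (hmem : v ∈ Submodule.span (MvPolynomial σ R) S) :
    v ∈ Submodule.span R S := by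
  have hself : (homogeneousComponent n).compLeft ι v = v :=
    funext fun i => homogeneousComponent_eq_self (hv i)
  exact hself ▸ homogeneousComponent_mem_span_of_mem_span hS hmem

theorem notMem_span_image_of_linearIndependent_of_isHomogeneous [Nontrivial R] {κ : Type*}
    {n : ℕ} {τ : κ → ι → MvPolynomial σ R} (hτ : LinearIndependent R τ)
    (hhom : ∀ j i, (τ j i).IsHomogeneous n) {s : Set κ} {j : κ} (hj : j ∉ s) :
    τ j ∉ Submodule.span (MvPolynomial σ R) (τ '' s) := fun hmem =>
  hτ.notMem_span_image hj <|
    mem_span_of_mem_span_of_isHomogeneous (Set.forall_mem_image.mpr fun k _ => hhom k) (hhom j) hmem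

theorem span_eq_span_of_linearIndependent_of_isHomogeneous {K : Type*} [Field K] {κ : Type*}
    [Finite κ] {n : ℕ} {ρ τ : κ → ι → MvPolynomial σ K} (hτ : LinearIndependent K τ)
    (hρ_hom : ∀ j i, (ρ j i).IsHomogeneous n) (hτ_hom : ∀ j i, (τ j i).IsHomogeneous n)
    (hτρ : ∀ j, τ j ∈ Submodule.span (MvPolynomial σ K) (Set.range ρ)) :
    Submodule.span (MvPolynomial σ K) (Set.range ρ) =
      Submodule.span (MvPolynomial σ K) (Set.range τ) := by
  cases nonempty_fintype κ
  have hle : Submodule.span K (Set.range τ) ≤ Submodule.span K (Set.range ρ) := by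
    rw [Submodule.span_le]
    rintro _ ⟨j, rfl⟩
    exact mem_span_of_mem_span_of_isHomogeneous (Set.forall_mem_range.mpr hρ_hom) (hτ_hom j)
      (hτρ j)
  have := FiniteDimensional.span_of_finite K (Set.finite_range ρ)
  have heq : Submodule.span K (Set.range τ) = Submodule.span K (Set.range ρ) :=
    Submodule.eq_of_le_of_finrank_le hle <| by
      rw [finrank_span_eq_card hτ]
      exact finrank_range_le_card ρ
  refine le_antisymm (Submodule.span_le.mpr ?_) (Submodule.span_le.mpr ?_)
  · rintro _ ⟨j, rfl⟩
    have hj : ρ j ∈ Submodule.span K (Set.range τ) := heq ▸ Submodule.subset_span ⟨j, rfl⟩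
    exact Submodule.span_le_restrictScalars K (MvPolynomial σ K) _ hj
  · rintro _ ⟨j, rfl⟩
    exact hτρ j

theorem apply_mem_pow_idealOfVars_of_mem_span {S : Set (ι → MvPolynomial σ R)} {n : ℕ}
    (hS : ∀ s ∈ S, ∀ i, (s i).IsHomogeneous n) {v : ι → MvPolynomial σ R}
    (hv : v ∈ Submodule.span (MvPolynomial σ R) S) (i : ι) : v i ∈ idealOfVars σ R ^ n := by
  have hle : Submodule.span (MvPolynomial σ R) S ≤
      Submodule.pi Set.univ fun _ => idealOfVars σ R ^ n :=
    Submodule.span_le.mpr fun s hs i _ =>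
      (mem_pow_idealOfVars_iff' n _).mpr fun _ hm => (hS s hs i).coeff_eq_zero hm.ne
  exact hle hv i trivial

theorem linearIndependent_of_forall_mem_pow_idealOfVars {A : Type*} [CommRing A] [Fintype ι]
    {n : ℕ} (hn : n ≠ 0) {w : ι → MvPolynomial σ A}
    (hw : ∀ r, w ⬝ᵥ r = 0 → ∀ i, r i ∈ idealOfVars σ A ^ n) :
    LinearIndependent A w := by
  rw [Fintype.linearIndependent_iff]
  intro α hα i
  have hrel : w ⬝ᵥ (fun i => C (α i)) = 0 := by
    simpa only [dotProduct, smul_eq_C_mul, mul_comm] using hα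
  exact ((C_mem_pow_idealOfVars_iff n (α i)).mp (hw _ hrel i)).resolve_right hn

theorem isRelPrime_of_forall_mem_pow_idealOfVars {K : Type*} [Field K] {n : ℕ}
    {p q : MvPolynomial σ K} (hp : p.IsHomogeneous n) (hp₀ : p ≠ 0)
    (hpq : ∀ a b, p * a = q * b → b ∈ idealOfVars σ K ^ n) : IsRelPrime p q := by
  rintro g ⟨u, hu⟩ ⟨v, hv⟩
  have hg₀ : g ≠ 0 := left_ne_zero_of_mul (hu ▸ hp₀)
  have hu₀ : u ≠ 0 := right_ne_zero_of_mul (hu ▸ hp₀)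
  have hmem : u ∈ idealOfVars σ K ^ n := hpq v u (by rw [hu, hv]; ring)
  have hdeg : n ≤ u.totalDegree := by
    obtain ⟨m, hm⟩ := support_nonempty.mpr hu₀
    exact ((mem_pow_idealOfVars_iff n u).mp hmem m hm).trans (le_totalDegree hm)
  have hdeg_mul : g.totalDegree + u.totalDegree = n := by
    rw [← totalDegree_mul_of_isDomain hg₀ hu₀, ← hu, hp.totalDegree hp₀]
  have hg : g = C (coeff 0 g) := totalDegree_eq_zero_iff_eq_C.mp (by omega)
  rw [hg] at hg₀ ⊢
  exact (isUnit_iff_ne_zero.mpr (C_ne_zero.mp hg₀)).map C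

end Homogeneous

section Points

variable {σ K : Type*} [Field K]

attribute [local instance] MvPolynomial.gradedAlgebra

/-- The ideal generated by the homogeneous polynomials vanishing at `p`: the homogeneous prime
ideal of the point of projective space with homogeneous coordinates `p`, when `p ≠ 0`. -/
noncomputable def projectivePointIdeal (p : σ → K) : Ideal (MvPolynomial σ K) :=
  ((RingHom.ker (eval p)).homogeneousCore (homogeneousSubmodule σ K)).toIdeal

instance isPrime_projectivePointIdeal (p : σ → K) : (projectivePointIdeal p).IsPrime :=
  (RingHom.ker_isPrime (eval p)).homogeneousCore

theorem mem_projectivePointIdeal_of_isHomogeneous {p : σ → K} {n : ℕ} {g : MvPolynomial σ K}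
    (hg : g.IsHomogeneous n) (hgp : eval p g = 0) : g ∈ projectivePointIdeal p :=
  Ideal.mem_homogeneousCore_of_homogeneous_of_mem ⟨n, hg⟩ hgp

theorem projectivePointIdeal_lt_ker_eval {p : σ → K} (hp : p ≠ 0) :
    projectivePointIdeal p < RingHom.ker (eval p) := by
  obtain ⟨i, hi⟩ := Function.ne_iff.mp hp
  refine lt_of_le_not_ge (Ideal.toIdeal_homogeneousCore_le _ _) fun hge => hi ?_
  have hmem : X i - C (p i) ∈ projectivePointIdeal p := hge (by simp [RingHom.mem_ker])
  have hconst := homogeneousComponent_mem_of_mem (HomogeneousIdeal.isHomogeneous _) hmem 0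
  have heval := RingHom.mem_ker.mp (Ideal.toIdeal_homogeneousCore_le _ _ hconst)
  simpa [homogeneousComponent_zero] using heval

theorem height_projectivePointIdeal_add_one_le [Finite σ] {p : σ → K} (hp : p ≠ 0) :
    (projectivePointIdeal p).height + 1 ≤ Nat.card σ := by
  have : (RingHom.ker (eval p)).IsPrime := RingHom.ker_isPrime (eval p)
  refine (Ideal.height_add_one_le_of_lt_of_isPrime (projectivePointIdeal_lt_ker_eval hp)).trans ?_
  have hdim := Ideal.height_le_ringKrullDim_of_isPrime (I := RingHom.ker (eval p))
  rw [ringKrullDim_of_isNoetherianRing, ringKrullDim_eq_zero_of_field, zero_add] at hdim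
  exact WithBot.coe_le_coe.mp hdim

theorem exists_X_pow_mem_of_zeroLocus_subset [IsAlgClosed K] [Finite σ]
    {I : Ideal (MvPolynomial σ K)} (hI : zeroLocus K I ⊆ {0}) (i : σ) : ∃ n, X i ^ n ∈ I := by
  have hmem : X i ∈ I.radical := by
    rw [← vanishingIdeal_zeroLocus_eq_radical (K := K)]
    intro p hp
    rw [Set.mem_singleton_iff.mp (hI hp), aeval_X, Pi.zero_apply]
  exact hmem

end Points

section Jacobian

/-- The vector `(f_x, f_y, f_z)`: the Jacobian syzygies are the vectors orthogonal to it, and the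
Koszul syzygies are its cross products with the standard basis vectors. -/
noncomputable def gradient (f : Poly) : Fin 3 → Poly := fun i => pderiv i f

variable {d : ℕ} {f : Poly}

theorem mem_jacobianSyzygies {r : Fin 3 → Poly} :
    r ∈ jacobianSyzygies f ↔ gradient f ⬝ᵥ r = 0 := by
  rw [dotProduct_comm]
  rfl

theorem koszulSyzygy_eq_cross (f : Poly) :
    koszulSyzygy f = fun j => gradient f ⨯₃ Pi.single j 1 := by
  funext j i
  fin_cases j <;> fin_cases i <;> simp [koszulSyzygy, gradient, cross_apply]

theorem span_koszulSyzygy (f : Poly) :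
    Submodule.span Poly (Set.range (koszulSyzygy f)) =
      LinearMap.range (crossProduct (gradient f)) := by
  rw [koszulSyzygy_eq_cross, span_range_cross_single]

theorem koszulSyzygy_mem_jacobianSyzygies (f : Poly) (j : Fin 3) :
    koszulSyzygy f j ∈ jacobianSyzygies f := by
  rw [mem_jacobianSyzygies, koszulSyzygy_eq_cross, dot_self_cross]

theorem isKoszulGenerated_iff :
    IsKoszulGenerated f ↔
      ∀ r, gradient f ⬝ᵥ r = 0 → r ∈ LinearMap.range (crossProduct (gradient f)) := by
  simp only [← mem_jacobianSyzygies, ← span_koszulSyzygy]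
  refine ⟨fun h _ hr => h.le hr, fun h => le_antisymm h (Submodule.span_le.mpr ?_)⟩
  exact Set.forall_mem_range.mpr (koszulSyzygy_mem_jacobianSyzygies f)

theorem isHomogeneous_koszulSyzygy (hf : f.IsHomogeneous d) (j i : Fin 3) :
    (koszulSyzygy f j i).IsHomogeneous (d - 1) := by
  have h (i : Fin 3) : (pderiv i f).IsHomogeneous (d - 1) := hf.pderiv
  fin_cases j <;> fin_cases i <;> simp [koszulSyzygy, isHomogeneous_zero, h, (h _).neg]

theorem isSmooth_iff (hd : d ≠ 0) (hf : f.IsHomogeneous d) :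
    IsSmooth f ↔ ∀ p, (∀ i, eval p (gradient f i) = 0) → p = 0 := by
  refine ⟨fun hs p hp => ?_, fun h p hp _ => ?_⟩
  · by_contra hne
    have heuler := congrArg (eval p) hf.sum_X_mul_pderiv
    simp only [map_sum, map_mul, map_nsmul, show ∀ i, eval p (pderiv i f) = 0 from hp, mul_zero,
      Finset.sum_const_zero] at heuler
    obtain ⟨i, hi⟩ := hs p hne ((smul_eq_zero.mp heuler.symm).resolve_left hd)
    exact hi (hp i)
  · by_contra! hsing
    exact hp (h p hsing)

theorem zeroLocus_span_gradient_subset (hd : d ≠ 0) (hf : f.IsHomogeneous d) (hs : IsSmooth f) :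
    zeroLocus ℂ (Ideal.span (Set.range (gradient f))) ⊆ {0} := fun p hp =>
  (isSmooth_iff hd hf).mp hs p fun i => hp _ (Ideal.subset_span ⟨i, rfl⟩)

theorem isKoszulGenerated_of_isSmooth (hd : d ≠ 0) (hf : f.IsHomogeneous d) (hs : IsSmooth f) :
    IsKoszulGenerated f := by
  choose n hn using exists_X_pow_mem_of_zeroLocus_subset (zeroLocus_span_gradient_subset hd hf hs)
  have hreg : IsWeaklyRegular Poly ([0, 1, 2].map fun i => (X i : Poly) ^ n i) :=
    isWeaklyRegular_map_X_pow (by decide) n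
  exact isKoszulGenerated_iff.mpr fun r hr => mem_range_cross_of_dotProduct_eq_zero hreg hn hr

theorem linearIndependent_gradient_of_span_eq {κ : Type*} {ρ : κ → Fin 3 → Poly} {n : ℕ}
    (hn : n ≠ 0) (hρ : ∀ j i, (ρ j i).IsHomogeneous n)
    (hspan : Submodule.span Poly (Set.range ρ) = jacobianSyzygies f) :
    LinearIndependent ℂ (gradient f) :=
  linearIndependent_of_forall_mem_pow_idealOfVars hn fun _ hr =>
    apply_mem_pow_idealOfVars_of_mem_span (Set.forall_mem_range.mpr hρ)
      (hspan ▸ mem_jacobianSyzygies.mpr hr)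

theorem linearIndependent_gradient_of_isKoszulGenerated (hd : 2 ≤ d) (hf : f.IsHomogeneous d)
    (hk : IsKoszulGenerated f) : LinearIndependent ℂ (gradient f) :=
  linearIndependent_gradient_of_span_eq (by omega) (isHomogeneous_koszulSyzygy hf) hk.symm

theorem linearIndependent_koszulSyzygy (h : LinearIndependent ℂ (gradient f)) :
    LinearIndependent ℂ (koszulSyzygy f) :=
  koszulSyzygy_eq_cross f ▸ linearIndependent_cross_single h

theorem isOfType_of_isKoszulGenerated (hd : 2 ≤ d) (hf : f.IsHomogeneous d)
    (hk : IsKoszulGenerated f) : IsOfType f d (d - 1) 3 := by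
  have hhom := isHomogeneous_koszulSyzygy hf
  have hind := linearIndependent_koszulSyzygy
    (linearIndependent_gradient_of_isKoszulGenerated hd hf hk)
  exact ⟨hf, monotone_const, koszulSyzygy f, hhom, hk.symm, fun j =>
    notMem_span_image_of_linearIndependent_of_isHomogeneous hind hhom (by simp)⟩

theorem isKoszulGenerated_of_isOfType (hd : 2 ≤ d) (h : IsOfType f d (d - 1) 3) :
    IsKoszulGenerated f := by
  obtain ⟨hf, -, ρ, hρ⟩ := h
  have hind := linearIndependent_koszulSyzygy
    (linearIndependent_gradient_of_span_eq (by omega) hρ.homogeneous hρ.span_eq)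
  rw [IsKoszulGenerated, ← hρ.span_eq]
  refine span_eq_span_of_linearIndependent_of_isHomogeneous hind hρ.homogeneous
    (isHomogeneous_koszulSyzygy hf) fun j => ?_
  rw [hρ.span_eq]
  exact koszulSyzygy_mem_jacobianSyzygies f j

theorem isRelPrime_gradient_of_isKoszulGenerated (hf : f.IsHomogeneous d)
    (hk : IsKoszulGenerated f) (hx : gradient f 0 ≠ 0) :
    IsRelPrime (gradient f 0) (gradient f 1) := by
  refine isRelPrime_of_forall_mem_pow_idealOfVars (hf.pderiv (i := 0)) hx fun a b hab => ?_
  have hsyz : ![a, -b, 0] ∈ jacobianSyzygies f := by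
    simp only [mem_jacobianSyzygies, dotProduct, Fin.sum_univ_three, cons_val]
    linear_combination hab
  have hmem := apply_mem_pow_idealOfVars_of_mem_span
    (Set.forall_mem_range.mpr (isHomogeneous_koszulSyzygy hf)) (hk ▸ hsyz) 1
  exact neg_mem_iff.mp hmem

theorem isSmooth_of_isKoszulGenerated (hd : 2 ≤ d) (hf : f.IsHomogeneous d)
    (hk : IsKoszulGenerated f) : IsSmooth f := by
  rw [isSmooth_iff (by omega) hf]
  intro p hsing
  by_contra hp
  have hx : gradient f 0 ≠ 0 :=
    (linearIndependent_gradient_of_isKoszulGenerated hd hf hk).ne_zero 0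
  have hlt : 2 < (projectivePointIdeal p).height :=
    two_lt_height_of_forall_mem_range_cross hx
      (isRelPrime_gradient_of_isKoszulGenerated hf hk hx) (isKoszulGenerated_iff.mp hk)
      fun i => mem_projectivePointIdeal_of_isHomogeneous hf.pderiv (hsing i)
  have hle : (projectivePointIdeal p).height ≤ 2 := by
    have h := height_projectivePointIdeal_add_one_le hp
    rw [Nat.card_fin] at h
    exact (ENat.add_le_add_iff_right (by simp)).mp (h.trans_eq (by norm_num))
  exact hlt.not_ge hle

end Jacobian

end PlaneCurve

theorem mainTheorem6_general {d : ℕ} (hd : 2 ≤ d) {f : MvPolynomial (Fin 3) ℂ}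
    (hf : f.IsHomogeneous d) :
    [PlaneCurve.IsOfType f d (d - 1) 3, PlaneCurve.IsSmooth f,
      PlaneCurve.IsKoszulGenerated f].TFAE := by
  tfae_have 1 → 3 := PlaneCurve.isKoszulGenerated_of_isOfType hd
  tfae_have 3 → 1 := PlaneCurve.isOfType_of_isKoszulGenerated hd hf
  tfae_have 3 → 2 := PlaneCurve.isSmooth_of_isKoszulGenerated hd hf
  tfae_have 2 → 3 := PlaneCurve.isKoszulGenerated_of_isSmooth (by omega) hf
  tfae_finish

theorem mainTheorem6 (d : ℕ) (hd : 3 ≤ d) (f : MvPolynomial (Fin 3) ℂ)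
    (hf : f.IsHomogeneous d) (hred : Squarefree f) :
    (PlaneCurve.IsOfType f d (d - 1) 3 ↔ PlaneCurve.IsSmooth f) ∧
      (PlaneCurve.IsSmooth f → PlaneCurve.IsKoszulGenerated f) := by
  have h := mainTheorem6_general (by omega) hf
  exact ⟨h.out 0 1, (h.out 1 2).mp⟩
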